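/- Let $Q$ be a finite-dimensional smooth manifold (without boundary), $L:TQ\to\mathbb R$ a smooth (possibly degenerate) Lagrangian and $\Delta_Q\subset TQ$ a regular (smooth, constant-rank) distribution. Write points of the Pontryagin bundle $TQ\oplus T^*Q$ as $(q,v,p)$, let $\mathrm{pr}_Q:TQ\oplus T^*Q\to Q$ and $\mathrm{pr}_{T^*Q}:TQ\oplus T^*Q\to T^*Q$ be the projections, let $\Omega=-d\theta$ be the canonical symplectic form of $T^*Q$ ($\theta=p\,dq$), and put $$\mathcal E(q,v,p)=p\cdot v-L(q,v),\qquad \mathcal K=\{(q,v,p): v\in\Delta_Q(q),\ p=\tfrac{\partial L}{\partial v}(q,v)\},\qquad \Delta_{TQ\oplus T^*Q}=(T\mathrm{pr}_Q)^{-1}(\Delta_Q),$$ $$D_{TQ\oplus T^*Q}(x)=\{(w,\alpha)\in T_x(TQ\oplus T^*Q)\oplus T_x^*(TQ\oplus T^*Q): w\in\Delta_{TQ\oplus T^*Q}(x),\ \alpha-(\mathrm{pr}_{T^*Q}^*\Omega)^\flat(w)\in\Delta^\circ_{TQ\oplus T^*Q}(x)\},$$ where $\Delta^\circ$ denotes the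 annihilator of $\Delta$. A *Lagrange–Dirac field* is a partial vector field $\tilde X$ on $TQ\oplus T^*Q$, i.e. an assignment of a vector $\tilde X(x)\in T_x(TQ\oplus T^*Q)$ to each $x\in\mathcal K$ (no regularity or tangency to $\mathcal K$ is required), such that $(\tilde X(x),d\mathcal E(x))\in D_{TQ\oplus T^*Q}(x)$ for all $x\in\mathcal K$; such a field is in general not unique. An *integral curve of the Lagrange–Dirac system* is a curve $x(t)\in\mathcal K$ with $(\dot x(t),d\mathcal E(x(t)))\in D_{TQ\oplus T^*Q}(x(t))$ for all $t$. An *integral curve of $\tilde X$* is a curve $x(t)\in\mathcal K$ with $\dot x(t)=\tilde X(x(t))$ for all $t$. The *Lagrange–Dirac equations* are, in local coordinates, $$p=\tfrac{\partial L}{\partial v}(q,v),\qquad \dot q\in\Delta_Q(q),\qquad \dot q=v,\qquad \dot p-\tfrac{\partial L}{\partial q}(q,v)\in\Delta_Q^\circ(q).$$ Curves are defined on open intervals of $\mathbb R$. **Corollary.** Let $\mathcal X$ be a smooth vector field and $\gamma$ a smooth one-form on $Q$, let $\Upsilon=\mathcal X\oplus\gamma:Q\to TQ\oplus T^*Q$,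 and assume that $\Upsilon(q)\in\mathcal K$ for all $q\in Q$ and that $d\gamma(v,w)=0$ for all $q\in Q$ and $v,w\in\Delta_Q(q)$. Let $\tilde X$ be any Lagrange–Dirac field. Then the following are equivalent. (i) For every curve $c$ in $Q$ with $\dot c(t)=T\mathrm{pr}_Q\cdot\tilde X(\Upsilon\circ c(t))$, the curve $\Upsilon\circ c$ is an integral curve of the Lagrange–Dirac system on $TQ\oplus T^*Q$, and it satisfies the Lagrange–Dirac equations. (i′) There is a Lagrange–Dirac field $\tilde Y$, equal to $\tilde X$ outside $\Upsilon(Q)$, such that for every curve $c$ in $Q$ with $\dot c(t)=T\mathrm{pr}_Q\cdot\tilde Y(\Upsilon\circ c(t))$, the curve $\Upsilon\circ c$ is an integral curve of $\tilde Y$, and it satisfies the Lagrange–Dirac equations. (ii) $d(\mathcal E\circ\Upsilon\circ\mathrm{pr}_Q)\in\Delta^\circ_{TQ\oplus T^*Q}$ at every point of $TQ\oplus T^*Q$. (ii′) $(0,d(\mathcal E\circ\Upsilon\circ\mathrm{pr}_Q))\in D_{TQ\oplus T^*Q}$ at every point of $TQ\oplus T^*Q$. In particular (take $\tilde Y=\tilde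 X$), if $\Upsilon\circ c$ is an integral curve of $\tilde X$ itself and satisfies the Lagrange–Dirac equations for every such $c$, then (ii) holds. -/

import Mathlib

open scoped Manifold ContDiff

noncomputable section

namespace DiracHJ

/-! ### One-forms, exterior derivative, annihilators and induced Dirac structures -/

section General

variable {E : Type*} [NormedAddCommGroup E] [NormedSpace ℝ E]
  {H : Type*} [TopologicalSpace H] (I : ModelWithCorners ℝ E H)
  {M : Type*} [TopologicalSpace M] [ChartedSpace H M]

/-- The cotangent space `T*_x M`. (`Bundle.Trivial M ℝ x` is the fibre `ℝ` of the trivial line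
bundle; in this form the vector bundle instances for `T*M` are found.) -/
abbrev CotangentSpace (x : M) : Type _ := TangentSpace I x →L[ℝ] Bundle.Trivial M ℝ x

/-- The differential `df (x)` of a real function, as a covector at `x`. -/
def differential (f : M → ℝ) (x : M) : CotangentSpace I x := mfderiv I 𝓘(ℝ, ℝ) f x

/-- The local representative of the one-form `α` in the preferred chart `φ` at `x`, i.e. the
pull-back `(φ⁻¹)^* α`. -/
def oneFormInChart (α : ∀ y : M, CotangentSpace I y) (x : M) (y : E) : E →L[ℝ] ℝ :=
  (α ((extChartAt I x).symm y)).comp (mfderiv 𝓘(ℝ, E) I (extChartAt I x).symm y)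

/-- The exterior derivative of a one-form on a manifold without boundary, written as
`v ↦ dα_x (v, ·)`. With `A` the local representative of `α` in the chart `φ` at `x`, the
two-form `dα` is the pull-back by `φ` of `(v, w) ↦ (DA · v) w - (DA · w) v`. -/
def exteriorDerivative (α : ∀ y : M, CotangentSpace I y) (x : M) (v : TangentSpace I x) :
    CotangentSpace I x :=
  let DA : E →L[ℝ] (E →L[ℝ] ℝ) := fderiv ℝ (oneFormInChart I α x) (extChartAt I x x)
  let Tφ : TangentSpace I x →L[ℝ] E := mfderiv I 𝓘(ℝ, E) (extChartAt I x) x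
  (DA (Tφ v) - DA.flip (Tφ v)).comp Tφ

variable {I}

/-- The annihilator `Δ°` of a distribution `Δ`, at the point `x`. -/
def annihilator (Δ : ∀ x : M, Submodule ℝ (TangentSpace I x)) (x : M) :
    Set (CotangentSpace I x) :=
  {α | ∀ w ∈ Δ x, α w = 0}

/-- The Dirac structure induced by a distribution `Δ` and a two-form given by its flat map
`v ↦ ω_x (v, ·)`. -/
def inducedDirac (Δ : ∀ x : M, Submodule ℝ (TangentSpace I x))
    (flat : ∀ x : M, TangentSpace I x → CotangentSpace I x) (x : M) :
    Set (TangentSpace I x × CotangentSpace I x) :=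
  {vα | vα.1 ∈ Δ x ∧ vα.2 - flat x vα.1 ∈ annihilator Δ x}

/-- A regular (smooth, constant rank) distribution: locally spanned by a smooth frame of
`k` linearly independent vector fields. -/
def IsRegularDistribution [IsManifold I 1 M]
    (Δ : ∀ x : M, Submodule ℝ (TangentSpace I x)) : Prop :=
  ∃ k : ℕ, ∀ x₀ : M, ∃ U : Set M, IsOpen U ∧ x₀ ∈ U ∧
    ∃ s : Fin k → ∀ x : M, TangentSpace I x,
      (∀ i, ContMDiffOn I I.tangent ∞
        (fun x => (⟨x, s i x⟩ : TangentBundle I M)) U) ∧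
      ∀ x ∈ U, LinearIndependent ℝ (fun i => s i x) ∧
        Submodule.span ℝ (Set.range fun i => s i x) = Δ x

variable (I)

/-- The curve `c` has velocity `w` at time `t`: `ċ(t) = w`. -/
def HasVelocityAt (c : ℝ → M) (t : ℝ) (w : TangentSpace I (c t)) : Prop :=
  HasMFDerivAt 𝓘(ℝ, ℝ) I c t ((1 : ℝ →L[ℝ] ℝ).smulRight w)

end General

/-! ### The cotangent bundle and the Pontryagin bundle -/

section Bundles

variable (E : Type*) [NormedAddCommGroup E] [NormedSpace ℝ E]
  (Q : Type*) [TopologicalSpace Q] [ChartedSpace E Q] [IsManifold 𝓘(ℝ, E) ∞ Q]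

/-- The cotangent bundle `T*Q`. -/
abbrev CotangentBundle : Type _ :=
  Bundle.TotalSpace (E →L[ℝ] ℝ) (fun q : Q => CotangentSpace 𝓘(ℝ, E) q)

/-- The Pontryagin bundle `TQ ⊕ T*Q` (Whitney sum); its points are `⟨q, (v, p)⟩`. -/
abbrev Pontryagin : Type _ :=
  Bundle.TotalSpace (E × (E →L[ℝ] ℝ))
    (fun q : Q => TangentSpace 𝓘(ℝ, E) q × CotangentSpace 𝓘(ℝ, E) q)

/-- The model with corners of `T*Q`. -/
abbrev modelCot := 𝓘(ℝ, E).prod 𝓘(ℝ, E →L[ℝ] ℝ)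

/-- The model with corners of `TQ ⊕ T*Q`. -/
abbrev modelPont := 𝓘(ℝ, E).prod 𝓘(ℝ, E × (E →L[ℝ] ℝ))

variable {E Q}

/-- The projection `pr_Q : TQ ⊕ T*Q → Q`. -/
abbrev prQ (x : Pontryagin E Q) : Q := x.proj

/-- The projection `pr_{T*Q} : TQ ⊕ T*Q → T*Q`. -/
abbrev prCot (x : Pontryagin E Q) : CotangentBundle E Q := ⟨x.proj, x.2.2⟩

/-- The cotangent bundle projection `π_Q : T*Q → Q`. -/
abbrev piQ (z : CotangentBundle E Q) : Q := z.proj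

/-- The canonical one-form `θ = p dq` of `T*Q`: `θ_z (w) = z (Tπ_Q w)`. -/
def canonicalOneForm (z : CotangentBundle E Q) : CotangentSpace (modelCot E) z :=
  z.2.comp (mfderiv (modelCot E) 𝓘(ℝ, E) piQ z)

/-- The flat map of the canonical symplectic form `Ω = -dθ = dq ∧ dp` of `T*Q`,
in coordinates `(δq, δp) ↦ (-δp, δq)`. -/
def omegaFlat (z : CotangentBundle E Q) (v : TangentSpace (modelCot E) z) :
    CotangentSpace (modelCot E) z :=
  -exteriorDerivative (modelCot E) canonicalOneForm z v

/-- The flat map of the two-form `pr_{T*Q}^* Ω` on `TQ ⊕ T*Q`. -/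
def pontFlat (x : Pontryagin E Q) (v : TangentSpace (modelPont E) x) :
    CotangentSpace (modelPont E) x :=
  let T : TangentSpace (modelPont E) x →L[ℝ] TangentSpace (modelCot E) (prCot x) :=
    mfderiv (modelPont E) (modelCot E) prCot x
  (omegaFlat (prCot x) (T v)).comp T

/-- The lifted distribution `Δ_{TQ ⊕ T*Q} = (T pr_Q)⁻¹ (Δ_Q)`. -/
def liftedDistribution (Δ : ∀ q : Q, Submodule ℝ (TangentSpace 𝓘(ℝ, E) q))
    (x : Pontryagin E Q) : Submodule ℝ (TangentSpace (modelPont E) x) :=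
  (Δ (prQ x)).comap (mfderiv (modelPont E) 𝓘(ℝ, E) prQ x).toLinearMap

/-- The induced Dirac structure `D_{TQ ⊕ T*Q}`. -/
def diracPont (Δ : ∀ q : Q, Submodule ℝ (TangentSpace 𝓘(ℝ, E) q)) (x : Pontryagin E Q) :
    Set (TangentSpace (modelPont E) x × CotangentSpace (modelPont E) x) :=
  inducedDirac (liftedDistribution Δ) pontFlat x

/-! ### Lagrange–Dirac systems on the Pontryagin bundle -/

/-- The Legendre transformation: the fibre derivative `∂L/∂v (q, v)`. -/
def legendre (L : TangentBundle 𝓘(ℝ, E) Q → ℝ) (q : Q) (v : TangentSpace 𝓘(ℝ, E) q) :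
    CotangentSpace 𝓘(ℝ, E) q :=
  fderiv ℝ (fun u : TangentSpace 𝓘(ℝ, E) q => L ⟨q, u⟩) v

/-- The generalized energy `ℰ (q, v, p) = p · v - L (q, v)`. -/
def energy (L : TangentBundle 𝓘(ℝ, E) Q → ℝ) (x : Pontryagin E Q) : ℝ :=
  x.2.2 x.2.1 - L ⟨x.proj, x.2.1⟩

/-- The set `𝒦 = {(q, v, p) : v ∈ Δ_Q (q), p = ∂L/∂v (q, v)}`. -/
def setK (L : TangentBundle 𝓘(ℝ, E) Q → ℝ)
    (Δ : ∀ q : Q, Submodule ℝ (TangentSpace 𝓘(ℝ, E) q)) : Set (Pontryagin E Q) :=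
  {x | x.2.1 ∈ Δ x.proj ∧ x.2.2 = legendre L x.proj x.2.1}

/-- `(ℰ, 𝒦, X)` is a Lagrange–Dirac system: `(X (x), dℰ (x)) ∈ D_{TQ ⊕ T*Q} (x)` for all
`x ∈ 𝒦`. Here `X` is a partial vector field: only its values at points of `𝒦` matter. -/
def IsLagrangeDiracField (L : TangentBundle 𝓘(ℝ, E) Q → ℝ)
    (Δ : ∀ q : Q, Submodule ℝ (TangentSpace 𝓘(ℝ, E) q))
    (X : ∀ x : Pontryagin E Q, TangentSpace (modelPont E) x) : Prop :=
  ∀ x ∈ setK L Δ, (X x, differential (modelPont E) (energy L) x) ∈ diracPont Δ x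

/-- `x : J → 𝒦` is an integral curve of the given partial vector field `X`. -/
def IsIntegralCurveOf (L : TangentBundle 𝓘(ℝ, E) Q → ℝ)
    (Δ : ∀ q : Q, Submodule ℝ (TangentSpace 𝓘(ℝ, E) q))
    (X : ∀ x : Pontryagin E Q, TangentSpace (modelPont E) x)
    (x : ℝ → Pontryagin E Q) (J : Set ℝ) : Prop :=
  ∀ t ∈ J, x t ∈ setK L Δ ∧ HasVelocityAt (modelPont E) x t (X (x t))

/-- `x : J → 𝒦` is an integral curve of the Lagrange–Dirac system on the Pontryagin bundle:
`(ẋ(t), dℰ (x(t))) ∈ D_{TQ ⊕ T*Q} (x(t))`. -/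
def IsLagrangeDiracCurve (L : TangentBundle 𝓘(ℝ, E) Q → ℝ)
    (Δ : ∀ q : Q, Submodule ℝ (TangentSpace 𝓘(ℝ, E) q))
    (x : ℝ → Pontryagin E Q) (J : Set ℝ) : Prop :=
  ∀ t ∈ J, x t ∈ setK L Δ ∧ ∃ w : TangentSpace (modelPont E) (x t),
    HasVelocityAt (modelPont E) x t w ∧
      (w, differential (modelPont E) (energy L) (x t)) ∈ diracPont Δ (x t)

/-- The point of `TQ` with coordinates `(q, v)` in the chart of `TQ` induced by the preferred
chart of `Q` at `q₀`. -/
def tangentOfCoord (q₀ : Q) (q v : E) : TangentBundle 𝓘(ℝ, E) Q :=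
  (extChartAt 𝓘(ℝ, E).tangent (⟨q₀, 0⟩ : TangentBundle 𝓘(ℝ, E) Q)).symm (q, v)

/-- The curve `x(t) = (q(t), v(t), p(t))` satisfies on `J` the Lagrange–Dirac equations
`p = ∂L/∂v`, `q̇ ∈ Δ_Q`, `q̇ = v`, `ṗ - ∂L/∂q ∈ Δ_Q°` in local coordinates. These are
invariant under changes of coordinates; at time `t` they are written in the coordinates of
`TQ ⊕ T*Q` induced by the preferred chart of `Q` at the base point of `x(t)`. -/
def SolvesLagrangeDiracEquations (L : TangentBundle 𝓘(ℝ, E) Q → ℝ)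
    (Δ : ∀ q : Q, Submodule ℝ (TangentSpace 𝓘(ℝ, E) q))
    (x : ℝ → Pontryagin E Q) (J : Set ℝ) : Prop :=
  ∀ t ∈ J,
    let coord : ℝ → E × E × (E →L[ℝ] ℝ) := fun s => extChartAt (modelPont E) (x t) (x s)
    let q : ℝ → E := fun s => (coord s).1
    let v : ℝ → E := fun s => (coord s).2.1
    let p : ℝ → E →L[ℝ] ℝ := fun s => (coord s).2.2
    let locL : E → E → ℝ := fun a b => L (tangentOfCoord (x t).proj a b)
    let inΔ : E → Prop := fun b =>
      (tangentOfCoord (x t).proj (q t) b).2 ∈ Δ (tangentOfCoord (x t).proj (q t) b).1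
    ContinuousAt x t ∧ ∃ (q' : E) (p' : E →L[ℝ] ℝ), HasDerivAt q q' t ∧ HasDerivAt p p' t ∧
      p t = fderiv ℝ (fun b => locL (q t) b) (v t) ∧
      inΔ q' ∧
      q' = v t ∧
      ∀ b : E, inΔ b → p' b - fderiv ℝ (fun a => locL a (v t)) (q t) b = 0

/-- The map `Υ = 𝒳 ⊕ γ : Q → TQ ⊕ T*Q`. -/
def upsilon (𝒳 : ∀ q : Q, TangentSpace 𝓘(ℝ, E) q) (γ : ∀ q : Q, CotangentSpace 𝓘(ℝ, E) q)
    (q : Q) : Pontryagin E Q :=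
  ⟨q, (𝒳 q, γ q)⟩

/-- `c : J → Q` satisfies `ċ(t) = T pr_Q · X (Υ (c(t)))`. -/
def IsDrivenBy (𝒳 : ∀ q : Q, TangentSpace 𝓘(ℝ, E) q)
    (γ : ∀ q : Q, CotangentSpace 𝓘(ℝ, E) q)
    (X : ∀ x : Pontryagin E Q, TangentSpace (modelPont E) x)
    (c : ℝ → Q) (J : Set ℝ) : Prop :=
  ∀ t ∈ J, HasVelocityAt 𝓘(ℝ, E) c t
    (mfderiv (modelPont E) 𝓘(ℝ, E) prQ (upsilon 𝒳 γ (c t)) (X (upsilon 𝒳 γ (c t))))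

end Bundles

end DiracHJ

end

noncomputable section

namespace DiracHJ

open Bundle

/-! Everything is computed in the bundle charts centred at the point considered, where a tangent
vector of `TQ ⊕ T*Q` is a triple `(δq, δv, δp)`. At a point of `𝒦` the relation `p = ∂L/∂v` cancels
the `v`-part of `dℰ`, and membership of `(w, dℰ)` in the Dirac structure becomes `δq = v` and `δp -
∂L/∂q ∈ Δ°`, with `δv` free (`mem_diracPont_iff`). Hence every Lagrange–Dirac field projects to `𝒳`
along `Υ(Q)`, and the driven curves are exactly the integral curves of `𝒳` (`isDrivenBy_iff`).

Along such a curve `Υ ∘ c` has velocity `TΥ · 𝒳`, with `p`-component `Dγ · 𝒳`, so the only equation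
left is `Dγ · 𝒳 - ∂L/∂q ∈ Δ°`. By the chain rule and `γ = ∂L/∂v`, `d(ℰ ∘ Υ) b = (Dγ · b) 𝒳 - ∂L/∂q
b`; for `b ∈ Δ` the condition `dγ(𝒳, b) = 0` replaces `(Dγ · b) 𝒳` by `(Dγ · 𝒳) b`
(`differential_energy_comp_upsilon`). Thus (ii) is that remaining equation at every point of `Q`,
and local integral curves of `𝒳` through each point recover it from (i) or (i′).

An arbitrary Lagrange–Dirac field need not equal `TΥ · 𝒳` on `Υ(Q)`: its `δv` is free and its `δp`
is fixed only modulo `Δ°`. This is why (i′) allows a change of the field there. -/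

theorem hasMFDerivAt_of_hasFDerivAt_comp_symm
    {E : Type*} [NormedAddCommGroup E] [NormedSpace ℝ E]
    {H : Type*} [TopologicalSpace H] {I : ModelWithCorners ℝ E H} [I.Boundaryless]
    {M : Type*} [TopologicalSpace M] [ChartedSpace H M]
    {F : Type*} [NormedAddCommGroup F] [NormedSpace ℝ F] {f : M → F} {x : M} {A : E →L[ℝ] F}
    (h : HasFDerivAt (f ∘ (extChartAt I x).symm) A (extChartAt I x x)) :
    HasMFDerivAt I 𝓘(ℝ, F) f x A := by
  refine ⟨?_, ?_⟩
  · have h1 : ContinuousAt ((f ∘ (extChartAt I x).symm) ∘ extChartAt I x) x :=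
      h.continuousAt.comp (continuousAt_extChartAt x)
    refine h1.congr ?_
    filter_upwards [extChartAt_source_mem_nhds (I := I) x] with y hy
    exact congrArg f ((extChartAt I x).left_inv hy)
  · rw [writtenInExtChartAt, extChartAt_model_space_eq_id]
    exact h.hasFDerivWithinAt

theorem hasMFDerivAt_of_hasFDerivAt
    {E : Type*} [NormedAddCommGroup E] [NormedSpace ℝ E]
    {H : Type*} [TopologicalSpace H] {I : ModelWithCorners ℝ E H}
    {M : Type*} [TopologicalSpace M] [ChartedSpace H M]
    {E' : Type*} [NormedAddCommGroup E'] [NormedSpace ℝ E']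
    {H' : Type*} [TopologicalSpace H'] {I' : ModelWithCorners ℝ E' H'}
    {M' : Type*} [TopologicalSpace M'] [ChartedSpace H' M']
    {f : M → M'} {x : M} {A : E →L[ℝ] E'} (hf : ContinuousAt f x)
    (h : HasFDerivAt (extChartAt I' (f x) ∘ f ∘ (extChartAt I x).symm) A (extChartAt I x x)) :
    HasMFDerivAt I I' f x A :=
  ⟨hf, h.hasFDerivWithinAt⟩

/-- The map is linear, hence its own derivative. With `T` the projection to the base it is the chart
form of `p dq`. -/
theorem hasFDerivAt_snd_comp_clm {U V W : Type*} [NormedAddCommGroup U] [NormedSpace ℝ U]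
    [NormedAddCommGroup V] [NormedSpace ℝ V] [NormedAddCommGroup W] [NormedSpace ℝ W]
    (T : V →L[ℝ] W) (y : U × (W →L[ℝ] ℝ)) :
    HasFDerivAt (fun y : U × (W →L[ℝ] ℝ) => y.2.comp T)
      (((ContinuousLinearMap.compL ℝ V W ℝ).flip T).comp
        (ContinuousLinearMap.snd ℝ U (W →L[ℝ] ℝ))) y :=
  (((ContinuousLinearMap.compL ℝ V W ℝ).flip T).comp
    (ContinuousLinearMap.snd ℝ U (W →L[ℝ] ℝ))).hasFDerivAt

/-! ### Coordinates on the tangent, cotangent and Pontryagin bundles -/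

variable {E : Type*} [NormedAddCommGroup E] [NormedSpace ℝ E]
  {Q : Type*} [TopologicalSpace Q] [ChartedSpace E Q] [IsManifold 𝓘(ℝ, E) ∞ Q]

/-- The coordinates of a tangent vector in the preferred chart at `q₀`. -/
def vectorCoord (q₀ q : Q) (v : TangentSpace 𝓘(ℝ, E) q) : E :=
  (trivializationAt E (fun q : Q => TangentSpace 𝓘(ℝ, E) q) q₀ ⟨q, v⟩).2

/-- The coordinates of a covector in the preferred chart at `q₀`. -/
def covectorCoord (q₀ q : Q) (p : CotangentSpace 𝓘(ℝ, E) q) : E →L[ℝ] ℝ :=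
  (trivializationAt (E →L[ℝ] ℝ) (fun q : Q => CotangentSpace 𝓘(ℝ, E) q) q₀ ⟨q, p⟩).2

theorem extChartAt_pontryagin (x z : Pontryagin E Q) :
    extChartAt (modelPont E) x z =
      (extChartAt 𝓘(ℝ, E) x.proj z.proj,
        vectorCoord x.proj z.proj z.2.1, covectorCoord x.proj z.proj z.2.2) := by
  rw [FiberBundle.extChartAt]
  rfl

theorem extChartAt_cotangent (x z : CotangentBundle E Q) :
    extChartAt (modelCot E) x z =
      (extChartAt 𝓘(ℝ, E) x.proj z.proj, covectorCoord x.proj z.proj z.2) := by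
  rw [FiberBundle.extChartAt]
  rfl

theorem extChartAt_tangent (x z : TangentBundle 𝓘(ℝ, E) Q) :
    extChartAt 𝓘(ℝ, E).tangent x z =
      (extChartAt 𝓘(ℝ, E) x.proj z.proj, vectorCoord x.proj z.proj z.2) := by
  rw [FiberBundle.extChartAt]
  rfl

theorem extChartAt_pontryagin_source (x : Pontryagin E Q) :
    (extChartAt (modelPont E) x).source =
      TotalSpace.proj ⁻¹' (extChartAt 𝓘(ℝ, E) x.proj).source := by
  ext z
  rw [FiberBundle.extChartAt]
  simp only [mfld_simps]
  exact ⟨fun h => h.1.1, fun h => ⟨⟨h, h, trivial⟩, h⟩⟩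

theorem extChartAt_cotangent_source (x : CotangentBundle E Q) :
    (extChartAt (modelCot E) x).source =
      TotalSpace.proj ⁻¹' (extChartAt 𝓘(ℝ, E) x.proj).source := by
  ext z
  rw [FiberBundle.extChartAt]
  simp only [mfld_simps]
  exact ⟨fun h => h.1.1, fun h => ⟨⟨h, trivial⟩, h⟩⟩

theorem extChartAt_tangent_source (x : TangentBundle 𝓘(ℝ, E) Q) :
    (extChartAt 𝓘(ℝ, E).tangent x).source =
      TotalSpace.proj ⁻¹' (extChartAt 𝓘(ℝ, E) x.proj).source := by
  ext z
  rw [FiberBundle.extChartAt]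
  simp

theorem covectorCoord_eq {q₀ q : Q} (p : CotangentSpace 𝓘(ℝ, E) q) :
    covectorCoord q₀ q p =
      p.comp ((trivializationAt E (fun q : Q => TangentSpace 𝓘(ℝ, E) q) q₀).symmL ℝ q) := by
  rw [covectorCoord, hom_trivializationAt_apply]
  ext v
  simp [ContinuousLinearMap.inCoordinates]

/-- The inverse of the tangent trivialization is the derivative of the inverse chart. This form
matches `oneFormInChart`. -/
theorem covectorCoord_eq_mfderiv {q₀ q : Q} (hq : q ∈ (extChartAt 𝓘(ℝ, E) q₀).source)
    (p : CotangentSpace 𝓘(ℝ, E) q) :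
    covectorCoord q₀ q p =
      p.comp (mfderiv 𝓘(ℝ, E) 𝓘(ℝ, E) (extChartAt 𝓘(ℝ, E) q₀).symm
        (extChartAt 𝓘(ℝ, E) q₀ q)) := by
  rw [covectorCoord_eq, TangentBundle.symmL_trivializationAt (by simpa using hq)]
  rw [show Set.range 𝓘(ℝ, E) = Set.univ by simp, mfderivWithin_univ]
  rfl

/-- Covectors are transported contragrediently to vectors, so the pairing does not depend on the
chart. -/
theorem covectorCoord_apply_vectorCoord {q₀ q : Q} (hq : q ∈ (extChartAt 𝓘(ℝ, E) q₀).source)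
    (p : CotangentSpace 𝓘(ℝ, E) q) (v : TangentSpace 𝓘(ℝ, E) q) :
    covectorCoord q₀ q p (vectorCoord q₀ q v) = p v := by
  have hq' : q ∈ (trivializationAt E (fun q : Q => TangentSpace 𝓘(ℝ, E) q) q₀).baseSet := by
    simpa using hq
  rw [covectorCoord_eq]
  have := Trivialization.symmL_continuousLinearMapAt (R := ℝ)
    (trivializationAt E (fun q : Q => TangentSpace 𝓘(ℝ, E) q) q₀) hq' v
  conv_rhs => rw [← this]
  rw [ContinuousLinearMap.comp_apply, Trivialization.continuousLinearMapAt_apply,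
    Trivialization.linearMapAt_apply, if_pos hq']
  rfl

@[simp] theorem vectorCoord_self (q : Q) (v : TangentSpace 𝓘(ℝ, E) q) : vectorCoord q q v = v := by
  exact (tangentBundleCore 𝓘(ℝ, E) Q).coordChange_self (achart E q) q (mem_chart_source E q) v

@[simp] theorem covectorCoord_self (q : Q) (p : CotangentSpace 𝓘(ℝ, E) q) :
    covectorCoord q q p = p := by
  ext v
  have := covectorCoord_apply_vectorCoord (mem_extChartAt_source (I := 𝓘(ℝ, E)) q) p v
  rwa [show vectorCoord q q v = v from vectorCoord_self q v] at this

theorem extChartAt_pontryagin_symm {x : Pontryagin E Q} {y : E × E × (E →L[ℝ] ℝ)}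
    (hy : y ∈ (extChartAt (modelPont E) x).target) :
    ((extChartAt (modelPont E) x).symm y).proj ∈ (extChartAt 𝓘(ℝ, E) x.proj).source ∧
    extChartAt 𝓘(ℝ, E) x.proj ((extChartAt (modelPont E) x).symm y).proj = y.1 ∧
    vectorCoord x.proj _ ((extChartAt (modelPont E) x).symm y).2.1 = y.2.1 ∧
    covectorCoord x.proj _ ((extChartAt (modelPont E) x).symm y).2.2 = y.2.2 := by
  have h1 := (extChartAt (modelPont E) x).map_target hy
  rw [extChartAt_pontryagin_source] at h1
  have h2 := (extChartAt (modelPont E) x).right_inv hy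
  rw [extChartAt_pontryagin] at h2
  refine ⟨h1, ?_, ?_, ?_⟩
  · exact congrArg (fun z => z.1) h2
  · exact congrArg (fun z => z.2.1) h2
  · exact congrArg (fun z => z.2.2) h2

theorem extChartAt_cotangent_symm {x : CotangentBundle E Q} {y : E × (E →L[ℝ] ℝ)}
    (hy : y ∈ (extChartAt (modelCot E) x).target) :
    ((extChartAt (modelCot E) x).symm y).proj ∈ (extChartAt 𝓘(ℝ, E) x.proj).source ∧
    extChartAt 𝓘(ℝ, E) x.proj ((extChartAt (modelCot E) x).symm y).proj = y.1 ∧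
    covectorCoord x.proj _ ((extChartAt (modelCot E) x).symm y).2 = y.2 := by
  have h1 := (extChartAt (modelCot E) x).map_target hy
  rw [extChartAt_cotangent_source] at h1
  have h2 := (extChartAt (modelCot E) x).right_inv hy
  rw [extChartAt_cotangent] at h2
  refine ⟨h1, ?_, ?_⟩
  · exact congrArg (fun z => z.1) h2
  · exact congrArg (fun z => z.2) h2

/-- The chart of `TQ` centred at the zero vector over `q₀` contains every fibre over the base chart
domain, so it serves for all `v`. -/
theorem tangentOfCoord_extChartAt {q₀ q : Q} (hq : q ∈ (extChartAt 𝓘(ℝ, E) q₀).source)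
    (v : TangentSpace 𝓘(ℝ, E) q) :
    tangentOfCoord q₀ (extChartAt 𝓘(ℝ, E) q₀ q) (vectorCoord q₀ q v) = ⟨q, v⟩ := by
  have h : (⟨q, v⟩ : TangentBundle 𝓘(ℝ, E) Q) ∈
      (extChartAt 𝓘(ℝ, E).tangent (⟨q₀, 0⟩ : TangentBundle 𝓘(ℝ, E) Q)).source := by
    rw [extChartAt_tangent_source]; exact hq
  have := (extChartAt 𝓘(ℝ, E).tangent (⟨q₀, 0⟩ : TangentBundle 𝓘(ℝ, E) Q)).left_inv h
  rwa [extChartAt_tangent] at this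

theorem tangentOfCoord_self (q : Q) (v : TangentSpace 𝓘(ℝ, E) q) :
    tangentOfCoord q (extChartAt 𝓘(ℝ, E) q q) v = ⟨q, v⟩ := by
  have := tangentOfCoord_extChartAt (mem_extChartAt_source (I := 𝓘(ℝ, E)) q) v
  rwa [show vectorCoord q q v = v from vectorCoord_self q v] at this

/-! ### Bundle projections and the canonical forms -/

theorem hasMFDerivAt_prQ (x : Pontryagin E Q) :
    HasMFDerivAt (modelPont E) 𝓘(ℝ, E) prQ x
      (ContinuousLinearMap.fst ℝ E (E × (E →L[ℝ] ℝ))) := by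
  refine hasMFDerivAt_of_hasFDerivAt
    (FiberBundle.continuous_proj (E × (E →L[ℝ] ℝ))
      (fun q : Q => TangentSpace 𝓘(ℝ, E) q × CotangentSpace 𝓘(ℝ, E) q)).continuousAt ?_
  refine (hasFDerivAt_fst (𝕜 := ℝ) (E := E) (F := E × (E →L[ℝ] ℝ))).congr_of_eventuallyEq ?_
  filter_upwards [extChartAt_target_mem_nhds (I := modelPont E) x] with y hy
  exact (extChartAt_pontryagin_symm hy).2.1

theorem hasMFDerivAt_piQ (x : CotangentBundle E Q) :
    HasMFDerivAt (modelCot E) 𝓘(ℝ, E) piQ x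
      (ContinuousLinearMap.fst ℝ E (E →L[ℝ] ℝ)) := by
  refine hasMFDerivAt_of_hasFDerivAt
    (FiberBundle.continuous_proj (E →L[ℝ] ℝ)
      (fun q : Q => CotangentSpace 𝓘(ℝ, E) q)).continuousAt ?_
  refine (hasFDerivAt_fst (𝕜 := ℝ) (E := E) (F := E →L[ℝ] ℝ)).congr_of_eventuallyEq ?_
  filter_upwards [extChartAt_target_mem_nhds (I := modelCot E) x] with y hy
  exact (extChartAt_cotangent_symm hy).2.1

/-- The Whitney sum carries the topology induced from `TQ × T*Q` by the diagonal map. -/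
theorem continuous_prCot : Continuous (prCot : Pontryagin E Q → CotangentBundle E Q) := by
  have h := (FiberBundle.Prod.isInducing_diag E (fun q : Q => TangentSpace 𝓘(ℝ, E) q) (E →L[ℝ] ℝ)
    (fun q : Q => CotangentSpace 𝓘(ℝ, E) q)).continuous
  exact continuous_snd.comp h

theorem hasMFDerivAt_prCot (x : Pontryagin E Q) :
    HasMFDerivAt (modelPont E) (modelCot E) prCot x
      ((ContinuousLinearMap.fst ℝ E (E × (E →L[ℝ] ℝ))).prod
        ((ContinuousLinearMap.snd ℝ E (E →L[ℝ] ℝ)).comp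
          (ContinuousLinearMap.snd ℝ E (E × (E →L[ℝ] ℝ))))) := by
  refine hasMFDerivAt_of_hasFDerivAt continuous_prCot.continuousAt ?_
  refine (ContinuousLinearMap.hasFDerivAt _).congr_of_eventuallyEq ?_
  filter_upwards [extChartAt_target_mem_nhds (I := modelPont E) x] with y hy
  obtain ⟨-, h1, -, h2⟩ := extChartAt_pontryagin_symm hy
  simp only [Function.comp_apply]
  rw [extChartAt_cotangent]
  exact Prod.ext h1 h2

theorem oneFormInChart_canonicalOneForm (z : CotangentBundle E Q) :
    oneFormInChart (modelCot E) canonicalOneForm z =ᶠ[nhds (extChartAt (modelCot E) z z)]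
      fun y => (y.2 : E →L[ℝ] ℝ).comp (ContinuousLinearMap.fst ℝ E (E →L[ℝ] ℝ)) := by
  filter_upwards [extChartAt_target_mem_nhds (I := modelCot E) z] with y hy
  have hty := (isOpen_extChartAt_target (I := modelCot E) z).mem_nhds hy
  obtain ⟨h1, h2, h3⟩ := extChartAt_cotangent_symm hy
  rw [covectorCoord_eq_mfderiv h1] at h3
  have hΨ : MDifferentiableAt 𝓘(ℝ, E × (E →L[ℝ] ℝ)) (modelCot E)
      (extChartAt (modelCot E) z).symm y :=
    (mdifferentiableWithinAt_extChartAt_symm hy).mdifferentiableAt (by simp)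
  have hy1 : y.1 ∈ (extChartAt 𝓘(ℝ, E) z.proj).target := h2 ▸ (extChartAt _ _).map_source h1
  have hφ : MDifferentiableAt 𝓘(ℝ, E) 𝓘(ℝ, E) (extChartAt 𝓘(ℝ, E) z.proj).symm y.1 :=
    (mdifferentiableWithinAt_extChartAt_symm hy1).mdifferentiableAt (by simp)
  have hfst : HasMFDerivAt 𝓘(ℝ, E × (E →L[ℝ] ℝ)) 𝓘(ℝ, E) (Prod.fst : E × (E →L[ℝ] ℝ) → E) y
    (ContinuousLinearMap.fst ℝ E (E →L[ℝ] ℝ)) := hasFDerivAt_fst.hasMFDerivAt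
  -- Differentiating the identity `π_Q ∘ Ψ⁻¹ = φ⁻¹ ∘ fst`, with `Ψ` the bundle chart and `φ` the
  -- base chart, in two ways turns `p ∘ Tπ_Q ∘ TΨ⁻¹` into the coordinate covector composed with
  -- `fst`.
  have e1 := (hasMFDerivAt_piQ ((extChartAt (modelCot E) z).symm y)).comp y hΨ.hasMFDerivAt
  have e2 : HasMFDerivAt 𝓘(ℝ, E × (E →L[ℝ] ℝ)) 𝓘(ℝ, E)
      (piQ ∘ (extChartAt (modelCot E) z).symm) y _ :=
    ((hφ.hasMFDerivAt).comp y hfst).congr_of_eventuallyEq (by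
      filter_upwards [hty] with y' hy'
      obtain ⟨h1', h2', -⟩ := extChartAt_cotangent_symm hy'
      simp only [Function.comp_apply]
      rw [← h2', (extChartAt 𝓘(ℝ, E) z.proj).left_inv h1'])
  have e3 := hasMFDerivAt_unique e1 e2
  rw [h2] at h3
  rw [oneFormInChart, canonicalOneForm, (hasMFDerivAt_piQ _).mfderiv, ← h3]
  refine ContinuousLinearMap.ext fun w => ?_
  have e4 := congrArg (fun A : (E × (E →L[ℝ] ℝ)) →L[ℝ] E => A w) e3
  exact congrArg ((extChartAt (modelCot E) z).symm y).2 e4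

set_option synthInstance.maxHeartbeats 200000 in
-- In the chart `θ` is `(q, p) ↦ p ∘ fst`, linear in `p`; antisymmetrizing its derivative gives `-dθ
-- = dq ∧ dp`.
theorem omegaFlat_apply (z : CotangentBundle E Q) (w w' : E × (E →L[ℝ] ℝ)) :
    omegaFlat z w w' = (w'.2 w.1 - w.2 w'.1 : ℝ) := by
  have h := hasFDerivAt_snd_comp_clm (U := E) (ContinuousLinearMap.fst ℝ E (E →L[ℝ] ℝ))
    (extChartAt (modelCot E) z z)
  have h' := (oneFormInChart_canonicalOneForm z).fderiv_eq.trans h.fderiv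
  unfold omegaFlat exteriorDerivative
  rw [mfderiv_extChartAt_self, h']
  change -(w.2 w'.1 - w'.2 w.1) = _
  ring

theorem pontFlat_apply (x : Pontryagin E Q) (w w' : E × E × (E →L[ℝ] ℝ)) :
    pontFlat x w w' = (w'.2.2 w.1 - w.2.2 w'.1 : ℝ) := by
  unfold pontFlat
  rw [(hasMFDerivAt_prCot x).mfderiv]
  exact omegaFlat_apply (prCot x) (w.1, w.2.2) (w'.1, w'.2.2)

/-! ### The Lagrangian and the energy in coordinates -/

theorem extChartAt_pontryagin_self (x : Pontryagin E Q) :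
    extChartAt (modelPont E) x x = (extChartAt 𝓘(ℝ, E) x.proj x.proj, x.2.1, x.2.2) := by
  rw [extChartAt_pontryagin,
    show vectorCoord x.proj x.proj x.2.1 = x.2.1 from vectorCoord_self _ _,
    show covectorCoord x.proj x.proj x.2.2 = x.2.2 from covectorCoord_self _ _]
  rfl

/-- The Lagrangian in the coordinates of `TQ` induced by the preferred chart at `q₀`. -/
def localLagrangian (L : TangentBundle 𝓘(ℝ, E) Q → ℝ) (q₀ : Q) (y : E × E) : ℝ :=
  L (tangentOfCoord q₀ y.1 y.2)

/-- The partial derivative `∂L/∂q` in the preferred chart at `q`. -/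
def baseDerivative (L : TangentBundle 𝓘(ℝ, E) Q → ℝ) (q : Q) (v : E) : E →L[ℝ] ℝ :=
  fderiv ℝ (fun a => localLagrangian L q (a, v)) (extChartAt 𝓘(ℝ, E) q q)

theorem differentiableAt_localLagrangian {L : TangentBundle 𝓘(ℝ, E) Q → ℝ}
    (hL : ContMDiff 𝓘(ℝ, E).tangent 𝓘(ℝ, ℝ) ∞ L) (q : Q) (v : E) :
    DifferentiableAt ℝ (localLagrangian L q) (extChartAt 𝓘(ℝ, E) q q, v) := by
  have hy : ((extChartAt 𝓘(ℝ, E) q q, v) : E × E) ∈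
      (extChartAt 𝓘(ℝ, E).tangent (⟨q, 0⟩ : TangentBundle 𝓘(ℝ, E) Q)).target := by
    have h : (⟨q, v⟩ : TangentBundle 𝓘(ℝ, E) Q) ∈
        (extChartAt 𝓘(ℝ, E).tangent (⟨q, 0⟩ : TangentBundle 𝓘(ℝ, E) Q)).source := by
      rw [extChartAt_tangent_source]; exact mem_extChartAt_source (I := 𝓘(ℝ, E)) q
    have h2 := (extChartAt 𝓘(ℝ, E).tangent (⟨q, 0⟩ : TangentBundle 𝓘(ℝ, E) Q)).map_source h
    rw [extChartAt_tangent] at h2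
    rwa [show vectorCoord q q v = v from vectorCoord_self q v] at h2
  have hΨ : MDifferentiableAt 𝓘(ℝ, E × E) 𝓘(ℝ, E).tangent
      (extChartAt 𝓘(ℝ, E).tangent (⟨q, 0⟩ : TangentBundle 𝓘(ℝ, E) Q)).symm
      (extChartAt 𝓘(ℝ, E) q q, v) :=
    (mdifferentiableWithinAt_extChartAt_symm hy).mdifferentiableAt (by simp)
  exact (((hL _).mdifferentiableAt (by simp)).comp _ hΨ).differentiableAt

theorem baseDerivative_eq {L : TangentBundle 𝓘(ℝ, E) Q → ℝ}
    (hL : ContMDiff 𝓘(ℝ, E).tangent 𝓘(ℝ, ℝ) ∞ L) (q : Q) (v : E) :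
    baseDerivative L q v = (fderiv ℝ (localLagrangian L q) (extChartAt 𝓘(ℝ, E) q q, v)).comp
      (ContinuousLinearMap.inl ℝ E E) := by
  have h := (differentiableAt_localLagrangian hL q v).hasFDerivAt.comp
    (extChartAt 𝓘(ℝ, E) q q) (hasFDerivAt_prodMk_left (𝕜 := ℝ) (extChartAt 𝓘(ℝ, E) q q) v)
  exact h.fderiv

/-- The chart centred at `q` is the identity on the fibre over `q`, so the intrinsic fibre
derivative is the coordinate partial derivative. -/
theorem legendre_eq {L : TangentBundle 𝓘(ℝ, E) Q → ℝ}
    (hL : ContMDiff 𝓘(ℝ, E).tangent 𝓘(ℝ, ℝ) ∞ L) (q : Q) (v : E) :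
    legendre L q v = (fderiv ℝ (localLagrangian L q) (extChartAt 𝓘(ℝ, E) q q, v)).comp
      (ContinuousLinearMap.inr ℝ E E) := by
  refine HasFDerivAt.fderiv ?_
  have h := (differentiableAt_localLagrangian hL q v).hasFDerivAt.comp
    v (hasFDerivAt_prodMk_right (extChartAt 𝓘(ℝ, E) q q) v)
  have e : localLagrangian L q ∘ (fun u => (extChartAt 𝓘(ℝ, E) q q, u)) =
      fun u : TangentSpace 𝓘(ℝ, E) q => L ⟨q, u⟩ :=
    funext fun u => congrArg L (tangentOfCoord_self q u)
  rw [e] at h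
  exact h

theorem hasFDerivAt_localLagrangian {L : TangentBundle 𝓘(ℝ, E) Q → ℝ}
    (hL : ContMDiff 𝓘(ℝ, E).tangent 𝓘(ℝ, ℝ) ∞ L) (q : Q) (v : E) :
    HasFDerivAt (localLagrangian L q)
      ((baseDerivative L q v).coprod (legendre L q v : E →L[ℝ] ℝ))
      (extChartAt 𝓘(ℝ, E) q q, v) := by
  rw [legendre_eq hL, baseDerivative_eq hL]
  refine (differentiableAt_localLagrangian hL q v).hasFDerivAt.congr_fderiv ?_
  refine ContinuousLinearMap.ext fun w => ?_
  change _ = fderiv ℝ (localLagrangian L q) (extChartAt 𝓘(ℝ, E) q q, v) (w.1, 0) +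
    fderiv ℝ (localLagrangian L q) (extChartAt 𝓘(ℝ, E) q q, v) (0, w.2)
  rw [← map_add]
  simp

/-- The differential of the generalized energy, in coordinates. -/
theorem hasMFDerivAt_energy {L : TangentBundle 𝓘(ℝ, E) Q → ℝ}
    (hL : ContMDiff 𝓘(ℝ, E).tangent 𝓘(ℝ, ℝ) ∞ L) (x : Pontryagin E Q) :
    ∃ A : E × E × (E →L[ℝ] ℝ) →L[ℝ] ℝ,
      HasMFDerivAt (modelPont E) 𝓘(ℝ, ℝ) (energy L) x A ∧
      ∀ w : E × E × (E →L[ℝ] ℝ), A w = w.2.2 x.2.1 + x.2.2 w.2.1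
        - baseDerivative L x.proj x.2.1 w.1 - legendre L x.proj x.2.1 w.2.1 := by
  set y₀ : E × E × (E →L[ℝ] ℝ) := (extChartAt 𝓘(ℝ, E) x.proj x.proj, x.2.1, x.2.2)
  have hx : extChartAt (modelPont E) x x = y₀ := extChartAt_pontryagin_self x
  have hv : HasFDerivAt (fun y : E × E × (E →L[ℝ] ℝ) => y.2.1)
      ((ContinuousLinearMap.fst ℝ E (E →L[ℝ] ℝ)).comp
          (ContinuousLinearMap.snd ℝ E (E × (E →L[ℝ] ℝ)))) y₀ :=
    ((ContinuousLinearMap.fst ℝ E (E →L[ℝ] ℝ)).comp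
          (ContinuousLinearMap.snd ℝ E (E × (E →L[ℝ] ℝ)))).hasFDerivAt
  have hp : HasFDerivAt (fun y : E × E × (E →L[ℝ] ℝ) => y.2.2)
      ((ContinuousLinearMap.snd ℝ E (E →L[ℝ] ℝ)).comp
          (ContinuousLinearMap.snd ℝ E (E × (E →L[ℝ] ℝ)))) y₀ :=
    ((ContinuousLinearMap.snd ℝ E (E →L[ℝ] ℝ)).comp
          (ContinuousLinearMap.snd ℝ E (E × (E →L[ℝ] ℝ)))).hasFDerivAt
  have hq : HasFDerivAt (fun y : E × E × (E →L[ℝ] ℝ) => y.1)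
      (ContinuousLinearMap.fst ℝ E (E × (E →L[ℝ] ℝ))) y₀ :=
    (ContinuousLinearMap.fst ℝ E (E × (E →L[ℝ] ℝ))).hasFDerivAt
  have h := (hp.clm_apply hv).sub
    ((hasFDerivAt_localLagrangian hL x.proj x.2.1).comp y₀ (hq.prodMk hv))
  have he : energy L ∘ (extChartAt (modelPont E) x).symm =ᶠ[nhds y₀]
      ((fun y => y.2.2 y.2.1) - localLagrangian L x.proj ∘ fun y => (y.1, y.2.1)) := by
    rw [← hx]
    filter_upwards [extChartAt_target_mem_nhds (I := modelPont E) x] with y hy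
    obtain ⟨h1, h2, h3, h4⟩ := extChartAt_pontryagin_symm hy
    have e1 := covectorCoord_apply_vectorCoord h1 ((extChartAt (modelPont E) x).symm y).2.2
      ((extChartAt (modelPont E) x).symm y).2.1
    have e2 := tangentOfCoord_extChartAt h1 ((extChartAt (modelPont E) x).symm y).2.1
    rw [h3, h4] at e1
    rw [h2, h3] at e2
    simp only [Function.comp_apply, energy, localLagrangian, Pi.sub_apply]
    rw [← e1, e2]
  have h' := h.congr_of_eventuallyEq he
  rw [← hx] at h'
  refine ⟨_, hasMFDerivAt_of_hasFDerivAt_comp_symm h', fun w => ?_⟩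
  rw [hx]
  change x.2.2 w.2.1 + w.2.2 x.2.1 -
    (baseDerivative L x.proj x.2.1 w.1 + legendre L x.proj x.2.1 w.2.1) = _
  ring

/-! ### The Dirac condition in coordinates -/

theorem mem_liftedDistribution_iff (Δ : ∀ q : Q, Submodule ℝ (TangentSpace 𝓘(ℝ, E) q))
    (x : Pontryagin E Q) (w : E × E × (E →L[ℝ] ℝ)) :
    (w : TangentSpace (modelPont E) x) ∈ liftedDistribution Δ x ↔
      (w.1 : TangentSpace 𝓘(ℝ, E) x.proj) ∈ Δ x.proj := by
  unfold liftedDistribution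
  rw [(hasMFDerivAt_prQ x).mfderiv]
  rfl

/-- Test vectors in the lifted distribution have arbitrary `v`- and `p`-components. The
`v`-components contribute nothing on `𝒦`, the `p`-components force `δq = v`, and the base components
in `Δ` give the momentum equation. -/
theorem mem_diracPont_iff {L : TangentBundle 𝓘(ℝ, E) Q → ℝ}
    (hL : ContMDiff 𝓘(ℝ, E).tangent 𝓘(ℝ, ℝ) ∞ L)
    (Δ : ∀ q : Q, Submodule ℝ (TangentSpace 𝓘(ℝ, E) q)) {x : Pontryagin E Q}
    (hx : x ∈ setK L Δ) (w : E × E × (E →L[ℝ] ℝ)) :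
    ((w : TangentSpace (modelPont E) x), differential (modelPont E) (energy L) x) ∈ diracPont Δ x ↔
      w.1 = x.2.1 ∧ ∀ b : E, (b : TangentSpace 𝓘(ℝ, E) x.proj) ∈ Δ x.proj →
        w.2.2 b = baseDerivative L x.proj x.2.1 b := by
  obtain ⟨A, hA, hAw⟩ := hasMFDerivAt_energy hL x
  have key : ∀ w' : E × E × (E →L[ℝ] ℝ),
      (differential (modelPont E) (energy L) x - pontFlat x w) w' =
      (w'.2.2 x.2.1 - w'.2.2 w.1 + (w.2.2 w'.1 - baseDerivative L x.proj x.2.1 w'.1) : ℝ) := by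
    intro w'
    have e : x.2.2 w'.2.1 = legendre L x.proj x.2.1 w'.2.1 := by rw [hx.2]
    have e1 : differential (modelPont E) (energy L) x = A := hA.mfderiv
    rw [e1]
    change A w' - pontFlat x w w' = _
    rw [hAw, pontFlat_apply, e]
    ring
  constructor
  · rintro ⟨h1, h2⟩
    have h2 : ∀ w' : E × E × (E →L[ℝ] ℝ), w'.1 ∈ Δ x.proj →
        (w'.2.2 x.2.1 - w'.2.2 w.1 +
          (w.2.2 w'.1 - baseDerivative L x.proj x.2.1 w'.1) : ℝ) = 0 := by
      intro w' hw'
      rw [← key]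
      exact h2 w' ((mem_liftedDistribution_iff Δ x w').2 hw')
    refine ⟨?_, fun b hb => ?_⟩
    -- Vertical test vectors `(0, 0, f)` compare `δq` and `v` under every functional `f`.
    · refine (SeparatingDual.eq_iff_forall_dual_eq (R := ℝ) (V := E)).2 fun f => ?_
      have h := h2 (0, 0, f) (Δ x.proj).zero_mem
      have h' : w.2.2 (0 : E) - baseDerivative L x.proj x.2.1 (0 : E) = 0 := by simp
      change f x.2.1 - f w.1 + (w.2.2 (0 : E) - baseDerivative L x.proj x.2.1 (0 : E)) = 0 at h
      rw [h', add_zero] at h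
      exact (sub_eq_zero.1 h).symm
    · have h := h2 (b, 0, 0) hb
      change (0 : ℝ) - 0 + (w.2.2 b - baseDerivative L x.proj x.2.1 b) = 0 at h
      linarith
  · rintro ⟨h1, h2⟩
    refine ⟨(mem_liftedDistribution_iff Δ x w).2 (h1 ▸ hx.1), fun w' hw' => ?_⟩
    refine (key w').trans ?_
    rw [h2 _ ((mem_liftedDistribution_iff Δ x w').1 hw'), h1]
    simp

/-! ### The derivative of `Υ` -/

theorem contMDiff_upsilon {𝒳 : ∀ q : Q, TangentSpace 𝓘(ℝ, E) q}
    (h𝒳 : ContMDiff 𝓘(ℝ, E) 𝓘(ℝ, E).tangent ∞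
      (fun q => (⟨q, 𝒳 q⟩ : TangentBundle 𝓘(ℝ, E) Q)))
    {γ : ∀ q : Q, CotangentSpace 𝓘(ℝ, E) q}
    (hγ : ContMDiff 𝓘(ℝ, E) (modelCot E) ∞ (fun q => (⟨q, γ q⟩ : CotangentBundle E Q))) :
    ContMDiff 𝓘(ℝ, E) (modelPont E) ∞ (upsilon 𝒳 γ) := by
  intro q
  have h1 := (contMDiffAt_totalSpace.1 (h𝒳 q)).2
  have h2 := (contMDiffAt_totalSpace.1 (hγ q)).2
  exact contMDiffAt_totalSpace.2 ⟨contMDiffAt_id, h1.prodMk_space h2⟩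

/-- The exterior derivative of a one-form in the preferred chart at `q`. -/
theorem exteriorDerivative_apply (γ : ∀ q : Q, CotangentSpace 𝓘(ℝ, E) q) (q : Q) (v w : E) :
    exteriorDerivative 𝓘(ℝ, E) γ q v w =
      (fderiv ℝ (oneFormInChart 𝓘(ℝ, E) γ q) (extChartAt 𝓘(ℝ, E) q q) v w -
        fderiv ℝ (oneFormInChart 𝓘(ℝ, E) γ q) (extChartAt 𝓘(ℝ, E) q q) w v : ℝ) := by
  unfold exteriorDerivative
  rw [mfderiv_extChartAt_self]
  rfl

/-- The derivative of `Υ = 𝒳 ⊕ γ`, in coordinates. -/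
theorem hasMFDerivAt_upsilon {𝒳 : ∀ q : Q, TangentSpace 𝓘(ℝ, E) q}
    (h𝒳 : ContMDiff 𝓘(ℝ, E) 𝓘(ℝ, E).tangent ∞
      (fun q => (⟨q, 𝒳 q⟩ : TangentBundle 𝓘(ℝ, E) Q)))
    {γ : ∀ q : Q, CotangentSpace 𝓘(ℝ, E) q}
    (hγ : ContMDiff 𝓘(ℝ, E) (modelCot E) ∞ (fun q => (⟨q, γ q⟩ : CotangentBundle E Q)))
    (q : Q) :
    ∃ A : E →L[ℝ] E × E × (E →L[ℝ] ℝ),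
      HasMFDerivAt 𝓘(ℝ, E) (modelPont E) (upsilon 𝒳 γ) q A ∧
      ∀ w : E, (A w).1 = w ∧
        (A w).2.2 = fderiv ℝ (oneFormInChart 𝓘(ℝ, E) γ q) (extChartAt 𝓘(ℝ, E) q q) w := by
  have hΥ := ((contMDiff_upsilon h𝒳 hγ q).mdifferentiableAt (by simp)).hasMFDerivAt
  obtain ⟨A, hA⟩ : ∃ A : E →L[ℝ] E × E × (E →L[ℝ] ℝ),
      HasMFDerivAt 𝓘(ℝ, E) (modelPont E) (upsilon 𝒳 γ) q A := ⟨_, hΥ⟩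
  refine ⟨A, hA, fun w => ⟨?_, ?_⟩⟩
  -- The base component is read off from `pr_Q ∘ Υ = id`.
  · have h1 := (hasMFDerivAt_prQ (upsilon 𝒳 γ q)).comp q hA
    have h2 : HasMFDerivAt 𝓘(ℝ, E) 𝓘(ℝ, E) (prQ ∘ upsilon 𝒳 γ) q (ContinuousLinearMap.id ℝ E) :=
      hasMFDerivAt_id q
    exact congrArg (fun B : E →L[ℝ] E => B w) (hasMFDerivAt_unique h1 h2)
  -- The covector component of `Υ` in the charts is the local representative of `γ`.
  · have h1 : HasFDerivAt (extChartAt (modelPont E) (upsilon 𝒳 γ q) ∘ upsilon 𝒳 γ ∘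
        (extChartAt 𝓘(ℝ, E) q).symm) A (extChartAt 𝓘(ℝ, E) q q) := by
      have := hA.2
      rw [show Set.range 𝓘(ℝ, E) = Set.univ by simp] at this
      exact hasFDerivWithinAt_univ.1 this
    have h2 := (((ContinuousLinearMap.snd ℝ E (E →L[ℝ] ℝ)).comp
      (ContinuousLinearMap.snd ℝ E (E × (E →L[ℝ] ℝ)))).hasFDerivAt).comp _ h1
    have h3 : HasFDerivAt (oneFormInChart 𝓘(ℝ, E) γ q)
        (((ContinuousLinearMap.snd ℝ E (E →L[ℝ] ℝ)).comp
          (ContinuousLinearMap.snd ℝ E (E × (E →L[ℝ] ℝ)))).comp A)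
        (extChartAt 𝓘(ℝ, E) q q) := by
      refine h2.congr_of_eventuallyEq ?_
      filter_upwards [extChartAt_target_mem_nhds (I := 𝓘(ℝ, E)) q] with y hy
      simp only [Function.comp_apply]
      rw [extChartAt_pontryagin]
      have hs := (extChartAt 𝓘(ℝ, E) q).map_target hy
      have e := covectorCoord_eq_mfderiv hs (γ ((extChartAt 𝓘(ℝ, E) q).symm y))
      rw [(extChartAt 𝓘(ℝ, E) q).right_inv hy] at e
      exact e.symm
    rw [h3.fderiv]
    rfl

/-! ### Velocities of curves and the Lagrange–Dirac equations -/

theorem hasDerivAt_of_hasFDerivAt_smulRight {F : Type*} [NormedAddCommGroup F] [NormedSpace ℝ F]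
    {f : ℝ → F} {t : ℝ} {w : F} (h : HasFDerivAt f ((1 : ℝ →L[ℝ] ℝ).smulRight w) t) :
    HasDerivAt f w t := by
  simpa using h.hasDerivAt

theorem HasVelocityAt.hasDerivAt_extChartAt {x : ℝ → Pontryagin E Q} {t : ℝ}
    {w : E × E × (E →L[ℝ] ℝ)} (h : HasVelocityAt (modelPont E) x t w) :
    HasDerivAt (fun s => (extChartAt (modelPont E) (x t) (x s) : E × E × (E →L[ℝ] ℝ))) w t := by
  have h2 := h.2
  rw [show Set.range 𝓘(ℝ, ℝ) = Set.univ by simp] at h2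
  exact hasDerivAt_of_hasFDerivAt_smulRight (hasFDerivWithinAt_univ.1 h2)

/-- The Lagrange–Dirac equations at a single time, in terms of the velocity of the curve. -/
theorem solvesLagrangeDiracEquations_singleton_iff {L : TangentBundle 𝓘(ℝ, E) Q → ℝ}
    {Δ : ∀ q : Q, Submodule ℝ (TangentSpace 𝓘(ℝ, E) q)} {x : ℝ → Pontryagin E Q} {t : ℝ}
    (hx : x t ∈ setK L Δ) {w : E × E × (E →L[ℝ] ℝ)}
    (hw : HasVelocityAt (modelPont E) x t w) :
    SolvesLagrangeDiracEquations L Δ x {t} ↔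
      w.1 = (x t).2.1 ∧ ∀ b : E, (b : TangentSpace 𝓘(ℝ, E) (x t).proj) ∈ Δ (x t).proj →
        w.2.2 b = baseDerivative L (x t).proj (x t).2.1 b := by
  have hd := hw.hasDerivAt_extChartAt
  have hq : HasDerivAt (fun s => (extChartAt (modelPont E) (x t) (x s)).1) w.1 t :=
    (ContinuousLinearMap.fst ℝ E (E × (E →L[ℝ] ℝ))).hasFDerivAt.comp_hasDerivAt t hd
  have hp : HasDerivAt (fun s => (extChartAt (modelPont E) (x t) (x s)).2.2) w.2.2 t :=
    ((ContinuousLinearMap.snd ℝ E (E →L[ℝ] ℝ)).comp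
      (ContinuousLinearMap.snd ℝ E (E × (E →L[ℝ] ℝ)))).hasFDerivAt.comp_hasDerivAt t hd
  have hcoord := extChartAt_pontryagin_self (x t)
  have hΔ : ∀ b : E, (tangentOfCoord (x t).proj
      (extChartAt 𝓘(ℝ, E) (x t).proj (x t).proj) b).2 ∈ Δ (tangentOfCoord (x t).proj
      (extChartAt 𝓘(ℝ, E) (x t).proj (x t).proj) b).1 ↔
      (b : TangentSpace 𝓘(ℝ, E) (x t).proj) ∈ Δ (x t).proj := fun b => by
    rw [tangentOfCoord_self (x t).proj b]
    rfl
  have hleg : fderiv ℝ (fun b : E => L (tangentOfCoord (x t).proj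
      (extChartAt 𝓘(ℝ, E) (x t).proj (x t).proj) b)) (x t).2.1 =
      legendre L (x t).proj (x t).2.1 := by
    have e : (fun b : E => L (tangentOfCoord (x t).proj
      (extChartAt 𝓘(ℝ, E) (x t).proj (x t).proj) b)) = fun b : E => L ⟨(x t).proj, b⟩ :=
      funext fun b => congrArg L (tangentOfCoord_self (x t).proj b)
    rw [e]
    rfl
  unfold SolvesLagrangeDiracEquations
  simp only [Set.mem_singleton_iff, forall_eq]
  rw [hcoord]
  simp only [hleg]
  constructor
  · rintro ⟨-, q', p', hq', hp', -, -, h1, h2⟩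
    rw [← hq'.unique hq, ← hp'.unique hp]
    exact ⟨h1, fun b hb => sub_eq_zero.1 (h2 b ((hΔ b).2 hb))⟩
  · rintro ⟨h1, h2⟩
    exact ⟨hw.1, w.1, w.2.2, hq, hp, hx.2, (hΔ _).2 (h1 ▸ hx.1), h1,
      fun b hb => sub_eq_zero.2 (h2 b ((hΔ b).1 hb))⟩

theorem HasVelocityAt.upsilon_comp {𝒳 : ∀ q : Q, TangentSpace 𝓘(ℝ, E) q}
    {γ : ∀ q : Q, CotangentSpace 𝓘(ℝ, E) q} {c : ℝ → Q} {t : ℝ} {v : E}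
    {A : E →L[ℝ] E × E × (E →L[ℝ] ℝ)}
    (hA : HasMFDerivAt 𝓘(ℝ, E) (modelPont E) (upsilon 𝒳 γ) (c t) A)
    (hc : HasVelocityAt 𝓘(ℝ, E) c t v) :
    HasVelocityAt (modelPont E) (upsilon 𝒳 γ ∘ c) t (A v) := by
  have h := hA.comp t hc
  have e : A.comp ((1 : ℝ →L[ℝ] ℝ).smulRight v) = (1 : ℝ →L[ℝ] ℝ).smulRight (A v) := by
    ext <;> simp
  exact h.congr_mfderiv e

/-- The Dirac condition fixes the base component of the field at `Υ(q)` to be `𝒳 q`, so the choice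
of field is irrelevant here. -/
theorem IsLagrangeDiracField.isDrivenBy_iff {L : TangentBundle 𝓘(ℝ, E) Q → ℝ}
    (hL : ContMDiff 𝓘(ℝ, E).tangent 𝓘(ℝ, ℝ) ∞ L)
    {Δ : ∀ q : Q, Submodule ℝ (TangentSpace 𝓘(ℝ, E) q)}
    {𝒳 : ∀ q : Q, TangentSpace 𝓘(ℝ, E) q} {γ : ∀ q : Q, CotangentSpace 𝓘(ℝ, E) q}
    (hΥ : ∀ q : Q, upsilon 𝒳 γ q ∈ setK L Δ)
    {X : ∀ x : Pontryagin E Q, TangentSpace (modelPont E) x}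
    (hX : IsLagrangeDiracField L Δ X) (c : ℝ → Q) (J : Set ℝ) :
    IsDrivenBy 𝒳 γ X c J ↔ ∀ t ∈ J, HasVelocityAt 𝓘(ℝ, E) c t (𝒳 (c t)) := by
  refine forall₂_congr fun t _ => ?_
  have h : mfderiv (modelPont E) 𝓘(ℝ, E) prQ (upsilon 𝒳 γ (c t)) (X (upsilon 𝒳 γ (c t))) =
      𝒳 (c t) := by
    rw [(hasMFDerivAt_prQ _).mfderiv]
    exact ((mem_diracPont_iff hL Δ (hΥ (c t)) _).1 (hX _ (hΥ (c t)))).1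
  rw [h]

/-- Local existence for ordinary differential equations. Uniqueness of the curve is never needed:
one curve through each point suffices to test the equations there. -/
theorem exists_hasVelocityAt [FiniteDimensional ℝ E] {𝒳 : ∀ q : Q, TangentSpace 𝓘(ℝ, E) q}
    (h𝒳 : ContMDiff 𝓘(ℝ, E) 𝓘(ℝ, E).tangent ∞
      (fun q => (⟨q, 𝒳 q⟩ : TangentBundle 𝓘(ℝ, E) Q))) (q : Q) :
    ∃ (c : ℝ → Q) (ε : ℝ), 0 < ε ∧ c 0 = q ∧
      ∀ t ∈ Set.Ioo (-ε) ε, HasVelocityAt 𝓘(ℝ, E) c t (𝒳 (c t)) := by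
  have : CompleteSpace E := FiniteDimensional.complete ℝ E
  obtain ⟨c, hc, h⟩ := exists_isMIntegralCurveAt_of_contMDiffAt_boundaryless (t₀ := 0)
    ((h𝒳 q).of_le (by simp))
  obtain ⟨ε, hε, h⟩ := Metric.eventually_nhds_iff_ball.1 h
  refine ⟨c, ε, hε, hc, fun t ht => h t ?_⟩
  rw [Real.ball_eq_Ioo]
  simpa using ht

/-- On `Δ`, `d(ℰ ∘ Υ)` is the defect of the last of the Lagrange–Dirac equations along the integral
curves of `𝒳`. -/
theorem differential_energy_comp_upsilon {L : TangentBundle 𝓘(ℝ, E) Q → ℝ}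
    (hL : ContMDiff 𝓘(ℝ, E).tangent 𝓘(ℝ, ℝ) ∞ L)
    {Δ : ∀ q : Q, Submodule ℝ (TangentSpace 𝓘(ℝ, E) q)}
    {𝒳 : ∀ q : Q, TangentSpace 𝓘(ℝ, E) q} {γ : ∀ q : Q, CotangentSpace 𝓘(ℝ, E) q}
    (hΥ : ∀ q : Q, upsilon 𝒳 γ q ∈ setK L Δ)
    (hdγ : ∀ q : Q, ∀ v ∈ Δ q, ∀ w ∈ Δ q, exteriorDerivative 𝓘(ℝ, E) γ q v w = 0)
    (x : Pontryagin E Q) {A : E →L[ℝ] E × E × (E →L[ℝ] ℝ)}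
    (hA : HasMFDerivAt 𝓘(ℝ, E) (modelPont E) (upsilon 𝒳 γ) x.proj A)
    (hA' : ∀ w : E, (A w).1 = w ∧ (A w).2.2 =
      fderiv ℝ (oneFormInChart 𝓘(ℝ, E) γ x.proj) (extChartAt 𝓘(ℝ, E) x.proj x.proj) w)
    (w : E × E × (E →L[ℝ] ℝ)) (hw : (w.1 : TangentSpace 𝓘(ℝ, E) x.proj) ∈ Δ x.proj) :
    differential (modelPont E) (energy L ∘ upsilon 𝒳 γ ∘ prQ) x w =
      ((A (𝒳 x.proj)).2.2 w.1 - baseDerivative L x.proj (𝒳 x.proj) w.1 : ℝ) := by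
  obtain ⟨B, hB, hBw⟩ := hasMFDerivAt_energy hL (upsilon 𝒳 γ x.proj)
  have h1 := hB.comp x (hA.comp x (hasMFDerivAt_prQ x))
  have h2 : differential (modelPont E) (energy L ∘ upsilon 𝒳 γ ∘ prQ) x w = B (A w.1) :=
    congrArg (fun T : E × E × (E →L[ℝ] ℝ) →L[ℝ] ℝ => T w) h1.mfderiv
  have h3 := hBw (A w.1)
  -- As `γ = ∂L/∂v` along `Υ`, the two terms containing the derivative of `𝒳` cancel.
  have h4 : (γ x.proj : E →L[ℝ] ℝ) (A w.1).2.1 = legendre L x.proj (𝒳 x.proj) (A w.1).2.1 :=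
    congrArg (fun p : E →L[ℝ] ℝ => p (A w.1).2.1) (hΥ x.proj).2
  -- Both `𝒳` and `w.1` lie in `Δ`, so `dγ` vanishes on them and the arguments of `Dγ` may be
  -- exchanged.
  have h5 := (exteriorDerivative_apply γ x.proj (𝒳 x.proj) w.1).symm.trans
    (hdγ x.proj _ (hΥ x.proj).1 _ hw)
  rw [h2, h3, (hA' w.1).1, (hA' w.1).2, (hA' (𝒳 x.proj)).2]
  change (fderiv ℝ (oneFormInChart 𝓘(ℝ, E) γ x.proj) (extChartAt 𝓘(ℝ, E) x.proj x.proj) w.1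
    (𝒳 x.proj) + (γ x.proj : E →L[ℝ] ℝ) (A w.1).2.1 - baseDerivative L x.proj (𝒳 x.proj) w.1 -
    legendre L x.proj (𝒳 x.proj) (A w.1).2.1 : ℝ) = _
  rw [h4]
  linear_combination -h5

theorem zero_mem_diracPont_iff (Δ : ∀ q : Q, Submodule ℝ (TangentSpace 𝓘(ℝ, E) q))
    (x : Pontryagin E Q) (α : CotangentSpace (modelPont E) x) :
    ((0 : TangentSpace (modelPont E) x), α) ∈ diracPont Δ x ↔
      α ∈ annihilator (liftedDistribution Δ) x := by
  have h : pontFlat x 0 = 0 := by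
    refine ContinuousLinearMap.ext fun w => ?_
    refine (pontFlat_apply x 0 w).trans ?_
    change (w.2.2 (0 : E) - (0 : ℝ) : ℝ) = 0
    simp
  simp only [diracPont, inducedDirac, Set.mem_ofPred_eq, h, sub_zero, Submodule.zero_mem, true_and]

end DiracHJ

end

/-! ### The equivalences -/

open DiracHJ in
theorem mainTheorem6
    {E : Type*} [NormedAddCommGroup E] [NormedSpace ℝ E] [FiniteDimensional ℝ E]
    {Q : Type*} [TopologicalSpace Q] [ChartedSpace E Q] [IsManifold 𝓘(ℝ, E) ∞ Q]
    (L : TangentBundle 𝓘(ℝ, E) Q → ℝ)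
    (hL : ContMDiff 𝓘(ℝ, E).tangent 𝓘(ℝ, ℝ) ∞ L)
    (Δ : ∀ q : Q, Submodule ℝ (TangentSpace 𝓘(ℝ, E) q))
    (hΔ : IsRegularDistribution Δ)
    (𝒳 : ∀ q : Q, TangentSpace 𝓘(ℝ, E) q)
    (h𝒳 : ContMDiff 𝓘(ℝ, E) 𝓘(ℝ, E).tangent ∞
      (fun q => (⟨q, 𝒳 q⟩ : TangentBundle 𝓘(ℝ, E) Q)))
    (γ : ∀ q : Q, CotangentSpace 𝓘(ℝ, E) q)
    (hγ : ContMDiff 𝓘(ℝ, E) (modelCot E) ∞ (fun q => (⟨q, γ q⟩ : CotangentBundle E Q)))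
    (hΥ : ∀ q : Q, upsilon 𝒳 γ q ∈ setK L Δ)
    (hdγ : ∀ q : Q, ∀ v ∈ Δ q, ∀ w ∈ Δ q, exteriorDerivative 𝓘(ℝ, E) γ q v w = 0)
    (X : ∀ x : Pontryagin E Q, TangentSpace (modelPont E) x)
    (hX : IsLagrangeDiracField L Δ X) :
    List.TFAE [
      ∀ (J : Set ℝ) (c : ℝ → Q), IsOpen J → J.OrdConnected → IsDrivenBy 𝒳 γ X c J →
        IsLagrangeDiracCurve L Δ (upsilon 𝒳 γ ∘ c) J ∧
          SolvesLagrangeDiracEquations L Δ (upsilon 𝒳 γ ∘ c) J,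
      ∃ Y : ∀ x : Pontryagin E Q, TangentSpace (modelPont E) x,
        IsLagrangeDiracField L Δ Y ∧ (∀ x ∉ Set.range (upsilon 𝒳 γ), Y x = X x) ∧
        ∀ (J : Set ℝ) (c : ℝ → Q), IsOpen J → J.OrdConnected → IsDrivenBy 𝒳 γ Y c J →
          IsIntegralCurveOf L Δ Y (upsilon 𝒳 γ ∘ c) J ∧
            SolvesLagrangeDiracEquations L Δ (upsilon 𝒳 γ ∘ c) J,
      ∀ x : Pontryagin E Q,
        differential (modelPont E) (energy L ∘ upsilon 𝒳 γ ∘ prQ) x ∈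
          annihilator (liftedDistribution Δ) x,
      ∀ x : Pontryagin E Q,
        ((0 : TangentSpace (modelPont E) x),
          differential (modelPont E) (energy L ∘ upsilon 𝒳 γ ∘ prQ) x) ∈ diracPont Δ x] := by
  choose A hA hA' using hasMFDerivAt_upsilon h𝒳 hγ
  have hiff : (∀ x : Pontryagin E Q,
      differential (modelPont E) (energy L ∘ upsilon 𝒳 γ ∘ prQ) x ∈
        annihilator (liftedDistribution Δ) x) ↔
      ∀ q : Q, ∀ b : E, (b : TangentSpace 𝓘(ℝ, E) q) ∈ Δ q →
        (A q (𝒳 q)).2.2 b = baseDerivative L q (𝒳 q) b := by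
    constructor
    · intro h q b hb
      -- The differential depends on the base point only, so one point over `q` is enough.
      have h1 := h (upsilon 𝒳 γ q) ((b, 0, 0) : E × E × (E →L[ℝ] ℝ))
        ((mem_liftedDistribution_iff Δ (upsilon 𝒳 γ q) (b, 0, 0)).2 hb)
      have h2 := differential_energy_comp_upsilon hL hΥ hdγ (upsilon 𝒳 γ q) (hA q) (hA' q)
        (b, 0, 0) hb
      exact sub_eq_zero.1 (h2.symm.trans h1)
    · intro h x w hw
      have hw' := (mem_liftedDistribution_iff Δ x w).1 hw
      exact (differential_energy_comp_upsilon hL hΥ hdγ x (hA _) (hA' _) w hw').trans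
        (sub_eq_zero.2 (h _ _ hw'))
  have hsolves : ∀ (J : Set ℝ) (c : ℝ → Q),
      (∀ t ∈ J, HasVelocityAt 𝓘(ℝ, E) c t (𝒳 (c t))) →
      (SolvesLagrangeDiracEquations L Δ (upsilon 𝒳 γ ∘ c) J ↔
        ∀ t ∈ J, ∀ b : E, (b : TangentSpace 𝓘(ℝ, E) (c t)) ∈ Δ (c t) →
          (A (c t) (𝒳 (c t))).2.2 b = baseDerivative L (c t) (𝒳 (c t)) b) := by
    intro J c hc
    have hs : SolvesLagrangeDiracEquations L Δ (upsilon 𝒳 γ ∘ c) J ↔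
        ∀ t ∈ J, SolvesLagrangeDiracEquations L Δ (upsilon 𝒳 γ ∘ c) {t} := by
      unfold SolvesLagrangeDiracEquations
      simp only [Set.mem_singleton_iff, forall_eq]
    rw [hs]
    refine forall₂_congr fun t ht => ?_
    rw [solvesLagrangeDiracEquations_singleton_iff (hΥ (c t)) ((hc t ht).upsilon_comp (hA (c t)))]
    exact and_iff_right ((hA' (c t) _).1)
  -- Only the Lagrange–Dirac equations enter, for an arbitrary Lagrange–Dirac field; this serves (i)
  -- with `X` and (i′) with `Y`.
  have hnec : ∀ Y : ∀ x : Pontryagin E Q, TangentSpace (modelPont E) x,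
      IsLagrangeDiracField L Δ Y →
      (∀ (J : Set ℝ) (c : ℝ → Q), IsOpen J → J.OrdConnected → IsDrivenBy 𝒳 γ Y c J →
        SolvesLagrangeDiracEquations L Δ (upsilon 𝒳 γ ∘ c) J) →
      ∀ q : Q, ∀ b : E, (b : TangentSpace 𝓘(ℝ, E) q) ∈ Δ q →
        (A q (𝒳 q)).2.2 b = baseDerivative L q (𝒳 q) b := by
    intro Y hY h q
    obtain ⟨c, ε, hε, rfl, hc⟩ := exists_hasVelocityAt h𝒳 q
    exact (hsolves _ c hc).1 (h _ c isOpen_Ioo Set.ordConnected_Ioo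
      ((hY.isDrivenBy_iff hL hΥ c _).2 hc)) 0 ⟨neg_lt_zero.2 hε, hε⟩
  tfae_have 1 → 3 := fun h => hiff.2 (hnec X hX fun J c hJ hJ' hc => (h J c hJ hJ' hc).2)
  tfae_have 2 → 3 := by
    rintro ⟨Y, hY, -, h⟩
    exact hiff.2 (hnec Y hY fun J c hJ hJ' hc => (h J c hJ hJ' hc).2)
  tfae_have 3 ↔ 4 := forall_congr' fun x => (zero_mem_diracPont_iff Δ x _).symm
  tfae_have 3 → 1 := by
    intro h J c _ _ hc
    rw [hiff] at h
    rw [hX.isDrivenBy_iff hL hΥ] at hc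
    refine ⟨fun t ht => ⟨hΥ (c t), A (c t) (𝒳 (c t)), (hc t ht).upsilon_comp (hA (c t)), ?_⟩,
      (hsolves J c hc).2 fun t _ => h (c t)⟩
    exact (mem_diracPont_iff hL Δ (hΥ (c t)) _).2 ⟨(hA' (c t) _).1, h (c t)⟩
  tfae_have 3 → 2 := by
    intro h
    rw [hiff] at h
    classical
    -- On `Υ(Q)` the field is set to `TΥ · 𝒳`, the velocity of `Υ ∘ c` along integral curves `c` of
    -- 𝒳; by (ii) it still satisfies the Dirac condition there.
    let Y : ∀ x : Pontryagin E Q, TangentSpace (modelPont E) x := fun x =>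
      if x ∈ Set.range (upsilon 𝒳 γ) then (A x.proj (𝒳 x.proj) : E × E × (E →L[ℝ] ℝ)) else X x
    have hYΥ : ∀ q, Y (upsilon 𝒳 γ q) = (A q (𝒳 q) : E × E × (E →L[ℝ] ℝ)) :=
      fun q => if_pos ⟨q, rfl⟩
    have hYX : ∀ x ∉ Set.range (upsilon 𝒳 γ), Y x = X x := fun x hx => if_neg hx
    have hY : IsLagrangeDiracField L Δ Y := by
      intro x hx
      by_cases hxΥ : x ∈ Set.range (upsilon 𝒳 γ)
      · obtain ⟨q, rfl⟩ := hxΥ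
        rw [hYΥ]
        exact (mem_diracPont_iff hL Δ (hΥ q) _).2 ⟨(hA' q _).1, h q⟩
      · rw [hYX x hxΥ]
        exact hX x hx
    refine ⟨Y, hY, hYX, fun J c _ _ hc => ?_⟩
    rw [hY.isDrivenBy_iff hL hΥ] at hc
    refine ⟨fun t ht => ⟨hΥ (c t), ?_⟩, (hsolves J c hc).2 fun t _ => h (c t)⟩
    have hv := (hc t ht).upsilon_comp (hA (c t))
    rw [← hYΥ] at hv
    exact hv
  tfae_finish
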